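/- Let $n\ge 0$. Index the rows of the staircase Young diagram $(n,n-1,\ldots,1)$ (English conventions) by $1,\ldots,n$ from top to bottom and the columns by $1,\ldots,n$ from left to right, so that its boxes are the pairs $(i,j)$ of positive integers with $i+j\le n+1$. A pipe dream of size $n$ is a filling of these boxes in which each box on the southeast boundary ($i+j=n+1$) contains an elbow tile (joining its west and north sides) and every other box contains either a cross tile (joining west to east and south to north) or a bump tile (joining west to north and south to east). The tiles form $n$ pipes travelling from the west side to the north side; a pipe is labelled by the row in which it starts. A pipe dream $P$ is a pipe dream for $w\in S_n$ if the labels of the pipes read along the north side from left to right are $w(1),\ldots,w(n)$, and it is reduced if no two pipes cross more than once. Let $\mathrm{PD}(w)$ be the set of reduced pipe dreams for $w$. A chute move takes place in a rectangle of boxes of the staircase (with at least two rows and two columns) whose northwest and southwest corners contain bump tiles, whose southeast corner contains a bump or elbow tile, and all of whose other boxes contain cross tiles; it changes the tile in the southwest corner to a cross tile and the tile in the northeast corner to a bump tile. The set $\mathrm{PD}(w)$ is partially ordered by declaring $P\le P'$ if $P'$ can be obtained from $P$ by a (possibly empty) sequence of chute moves between elements of $\mathrm{PD}(w)$. For $w\in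 S_n$, define $w^{\mathrm{Tri}}\in S_{2n}$ by $w^{\mathrm{Tri}}(i)=i$ for $1\le i\le n$ and $w^{\mathrm{Tri}}(i)=2n+1-w(2n+1-i)$ for $n+1\le i\le 2n$. For a pipe dream $P$ of size $n$, let $P^{\mathrm{Tri}}$ be the pipe dream of size $2n$ in which, for all $i,j\in\{1,\ldots,n\}$ with $i+j\le n$, box $(n+1-j,\,n+1-i)$ contains the same type of tile as box $(i,j)$ of $P$, the boxes on the southeast boundary contain elbow tiles, and all other boxes contain bump tiles. **Proposition.** Let $w\in S_n$. If $P\in\mathrm{PD}(w)$, then $P^{\mathrm{Tri}}\in\mathrm{PD}(w^{\mathrm{Tri}})$. Moreover, there are $A\le B$ in $\mathrm{PD}(w^{\mathrm{Tri}})$ such that the map $P\mapsto P^{\mathrm{Tri}}$ is a poset isomorphism from $\mathrm{PD}(w)$ onto the interval $[A,B]=\{Q\in\mathrm{PD}(w^{\mathrm{Tri}}):A\le Q\le B\}$. -/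

import Mathlib

/-! Rows, columns, pipes and the letters of permutations are indexed from `0`. -/

/-- The boxes of the staircase `(n, n-1, …, 1)` (English conventions): the pair `(i, j)` is the box
in row `i` (from top to bottom) and column `j` (from left to right). -/
abbrev Box (n : ℕ) : Type := {b : ℕ × ℕ // b.1 + b.2 < n}

/-- The three kinds of tiles. -/
inductive Tile : Type
  | elbow
  | cross
  | bump

/-- A pipe dream: a filling of the boxes of the staircase in which the boxes on the southeast
boundary are filled with elbow tiles and all other boxes with cross tiles or bump tiles. -/
@[ext]
structure PipeDream (n : ℕ) : Type where
  tile : Box n → Tile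
  elbow_iff : ∀ b : Box n, tile b = Tile.elbow ↔ b.1.1 + b.1.2 + 1 = n

/-- The sides through which a pipe can enter a box. -/
inductive Side : Type
  | west
  | south

namespace PipeDream

variable {n : ℕ}

/-- `(i, j)` is a box of the staircase and is filled with a tile of type `t`. -/
def HasTile (P : PipeDream n) (t : Tile) (i j : ℕ) : Prop :=
  ∃ h : i + j < n, P.tile ⟨(i, j), h⟩ = t

/-- `P.Enters p s i j`: pipe `p`, which starts on the west side of the staircase in row `p`, enters
box `(i, j)` through side `s`. A cross tile is traversed straight; a bump tile joins its west side
to its north side and its south side to its east side; an elbow tile joins its west side to its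
north side. -/
inductive Enters (P : PipeDream n) (p : Fin n) : Side → ℕ → ℕ → Prop
  | start : Enters P p Side.west p 0
  | cross_east {i j : ℕ} : Enters P p Side.west i j → P.HasTile Tile.cross i j →
      Enters P p Side.west i (j + 1)
  | cross_north {i j : ℕ} : Enters P p Side.south (i + 1) j → P.HasTile Tile.cross (i + 1) j →
      Enters P p Side.south i j
  | bump_north {i j : ℕ} : Enters P p Side.west (i + 1) j → P.HasTile Tile.bump (i + 1) j →
      Enters P p Side.south i j
  | bump_east {i j : ℕ} : Enters P p Side.south i j → P.HasTile Tile.bump i j →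
      Enters P p Side.west i (j + 1)
  | elbow_north {i j : ℕ} : Enters P p Side.west (i + 1) j → P.HasTile Tile.elbow (i + 1) j →
      Enters P p Side.south i j

/-- Pipe `p` leaves the staircase through the north side of the top box of column `j`. -/
def ExitsAt (P : PipeDream n) (p : Fin n) (j : ℕ) : Prop :=
  (P.Enters p Side.south 0 j ∧ P.HasTile Tile.cross 0 j) ∨
    (P.Enters p Side.west 0 j ∧ (P.HasTile Tile.bump 0 j ∨ P.HasTile Tile.elbow 0 j))

/-- `P` is a pipe dream for `w`: the labels of the pipes read along the north side, from left to
right, are `w 0, w 1, …, w (n - 1)`. -/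
def IsFor (P : PipeDream n) (w : Equiv.Perm (Fin n)) : Prop :=
  ∀ j : Fin n, P.ExitsAt (w j) j

/-- Pipes `p` and `q` cross each other in box `(i, j)`. -/
def CrossAt (P : PipeDream n) (p q : Fin n) (i j : ℕ) : Prop :=
  P.HasTile Tile.cross i j ∧
    ((P.Enters p Side.west i j ∧ P.Enters q Side.south i j) ∨
      (P.Enters q Side.west i j ∧ P.Enters p Side.south i j))

/-- No two pipes cross each other more than once. -/
def IsReduced (P : PipeDream n) : Prop :=
  ∀ p q : Fin n, p ≠ q → ∀ i j i' j' : ℕ,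
    P.CrossAt p q i j → P.CrossAt p q i' j' → i = i' ∧ j = j'

/-- `P'` is obtained from `P` by a (generalized) chute move, which takes place in the rectangle
with rows `r₁, …, r₂` and columns `c₁, …, c₂`. -/
def ChuteMove (P P' : PipeDream n) : Prop :=
  ∃ r₁ r₂ c₁ c₂ : ℕ, r₁ < r₂ ∧ c₁ < c₂ ∧
    -- the tiles of `P` in the rectangle
    P.HasTile Tile.bump r₁ c₁ ∧ P.HasTile Tile.bump r₂ c₁ ∧
    (P.HasTile Tile.bump r₂ c₂ ∨ P.HasTile Tile.elbow r₂ c₂) ∧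
    (∀ i j : ℕ, r₁ ≤ i → i ≤ r₂ → c₁ ≤ j → j ≤ c₂ →
      (i, j) ≠ (r₁, c₁) → (i, j) ≠ (r₂, c₁) → (i, j) ≠ (r₂, c₂) → P.HasTile Tile.cross i j) ∧
    -- the tiles of `P'`
    P'.HasTile Tile.cross r₂ c₁ ∧ P'.HasTile Tile.bump r₁ c₂ ∧
    (∀ b : Box n, b.1 ≠ (r₂, c₁) → b.1 ≠ (r₁, c₂) → P'.tile b = P.tile b)

/-- The set of reduced pipe dreams for `w`. -/
def PD (w : Equiv.Perm (Fin n)) : Set (PipeDream n) :=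
  {P | P.IsFor w ∧ P.IsReduced}

/-! The sum of the row indices of the cross tiles increases under chute moves, so that the relation
generated by chute moves is antisymmetric. -/

open Classical in
/-- The sum of the row indices of the cross tiles. -/
noncomputable def rowSum (P : PipeDream n) : ℕ :=
  ∑ b ∈ Finset.range n ×ˢ Finset.range n, if P.HasTile Tile.cross b.1 b.2 then b.1 else 0

theorem ChuteMove.rowSum_lt {P P' : PipeDream n} (h : P.ChuteMove P') : P.rowSum < P'.rowSum := by
  classical
  obtain ⟨r₁, r₂, c₁, c₂, hr, hc, -, h2, h3, hX, h5, h6, h7⟩ := h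
  have h4 : P.HasTile Tile.cross r₁ c₂ :=
    hX r₁ c₂ le_rfl hr.le hc.le le_rfl (by simp; omega) (by simp; omega) (by simp; omega)
  have hb : r₂ + c₂ < n := by
    rcases h3 with ⟨h, -⟩ | ⟨h, -⟩ <;> exact h
  have key : ∀ b ∈ Finset.range n ×ˢ Finset.range n,
      (if P'.HasTile Tile.cross b.1 b.2 then b.1 else 0) + (if b = (r₁, c₂) then r₁ else 0)
      = (if P.HasTile Tile.cross b.1 b.2 then b.1 else 0) + (if b = (r₂, c₁) then r₂ else 0) := by
    rintro ⟨i, j⟩ -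
    by_cases e1 : (i, j) = (r₁, c₂)
    · have e2 : ¬ (i, j) = (r₂, c₁) := by
        rw [e1]; simp; omega
      obtain ⟨rfl, rfl⟩ := Prod.mk.inj e1
      have h6' : ¬ P'.HasTile Tile.cross i j := by
        rintro ⟨_, h⟩
        obtain ⟨_, h'⟩ := h6
        rw [h] at h'
        cases h'
      simp [h6', h4, e2]
    · by_cases e2 : (i, j) = (r₂, c₁)
      · obtain ⟨rfl, rfl⟩ := Prod.mk.inj e2
        have h2' : ¬ P.HasTile Tile.cross i j := by
          rintro ⟨_, h⟩
          obtain ⟨_, h'⟩ := h2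
          rw [h] at h'
          cases h'
        simp [h2', h5, e1]
      · have e : P'.HasTile Tile.cross i j ↔ P.HasTile Tile.cross i j :=
          exists_congr fun h => by rw [h7 ⟨(i, j), h⟩ e2 e1]
        simp [e, e1, e2]
  have hs := Finset.sum_congr rfl key
  rw [Finset.sum_add_distrib, Finset.sum_add_distrib, Finset.sum_ite_eq', Finset.sum_ite_eq',
    if_pos (by simp; omega), if_pos (by simp; omega)] at hs
  unfold rowSum
  omega

/-- The chute move poset: `P ≤ P'` if `P'` is obtained from `P` by a (possibly empty) sequence of
chute moves. -/
instance (w : Equiv.Perm (Fin n)) : PartialOrder (PD w) where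
  le P P' := Relation.ReflTransGen (fun Q Q' : PD w => Q.1.ChuteMove Q'.1) P P'
  le_refl _ := Relation.ReflTransGen.refl
  le_trans _ _ _ := Relation.ReflTransGen.trans
  le_antisymm P P' h h' := by
    have mono : ∀ {Q Q' : PD w},
        Relation.ReflTransGen (fun Q Q' : PD w => Q.1.ChuteMove Q'.1) Q Q' →
        Q = Q' ∨ Q.1.rowSum < Q'.1.rowSum := by
      intro Q Q' hQ
      induction hQ with
      | refl => exact Or.inl rfl
      | tail _ hc ih =>
        rcases ih with rfl | ih
        · exact Or.inr hc.rowSum_lt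
        · exact Or.inr (ih.trans hc.rowSum_lt)
    rcases mono h with e | e
    · exact e
    · rcases mono h' with e' | e'
      · exact e'.symm
      · omega

/-- The pipe dream `P^Tri`: the tile of `P` in a box off the southeast boundary is moved by the
reflection `(i, j) ↦ (n - 1 - j, n - 1 - i)`; the boxes on the southeast boundary are filled with
elbow tiles, and all remaining boxes are filled with bump tiles. -/
def triforce (P : PipeDream n) : PipeDream (2 * n) where
  tile b :=
    if b.1.1 + b.1.2 + 1 = 2 * n then Tile.elbow
    else if h : b.1.1 < n ∧ b.1.2 < n ∧ n ≤ b.1.1 + b.1.2 then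
      P.tile ⟨(n - 1 - b.1.2, n - 1 - b.1.1), by
        obtain ⟨h1, h2, h3⟩ := h
        show n - 1 - b.1.2 + (n - 1 - b.1.1) < n
        omega⟩
    else Tile.bump
  elbow_iff b := by
    by_cases h1 : b.1.1 + b.1.2 + 1 = 2 * n
    · simp [h1]
    · by_cases h2 : b.1.1 < n ∧ b.1.2 < n ∧ n ≤ b.1.1 + b.1.2
      · rw [if_neg h1, dif_pos h2, P.elbow_iff]
        simp only [h1, iff_false]
        omega
      · rw [if_neg h1, dif_neg h2]
        simp [h1]

end PipeDream

/-- The permutation `w^Tri`: with letters `0, …, 2n - 1`, it fixes `i < n` and sends `i ≥ n` to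
`2n - 1 - w (2n - 1 - i)`. -/
def triforcePerm {n : ℕ} (w : Equiv.Perm (Fin n)) : Equiv.Perm (Fin (2 * n)) where
  toFun i :=
    if h : i.1 < n then i else ⟨2 * n - 1 - (w ⟨2 * n - 1 - i.1, by omega⟩).1, by omega⟩
  invFun i :=
    if h : i.1 < n then i else ⟨2 * n - 1 - (w.symm ⟨2 * n - 1 - i.1, by omega⟩).1, by omega⟩
  left_inv i := by
    by_cases h : i.1 < n
    · simp [h]
    · have h1 := (w ⟨2 * n - 1 - i.1, by omega⟩).2
      have h2 : ¬ (2 * n - 1 - (w ⟨2 * n - 1 - i.1, by omega⟩).1 < n) := by omega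
      have h3 : ∀ x : Fin n, 2 * n - 1 - (2 * n - 1 - x.1) = x.1 := fun x => by omega
      ext
      simp only [h, h2, dif_neg, not_false_eq_true, h3, Fin.eta, Equiv.symm_apply_apply]
      omega
  right_inv i := by
    by_cases h : i.1 < n
    · simp [h]
    · have h1 := (w.symm ⟨2 * n - 1 - i.1, by omega⟩).2
      have h2 : ¬ (2 * n - 1 - (w.symm ⟨2 * n - 1 - i.1, by omega⟩).1 < n) := by omega
      have h3 : ∀ x : Fin n, 2 * n - 1 - (2 * n - 1 - x.1) = x.1 := fun x => by omega
      ext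
      simp only [h, h2, dif_neg, not_false_eq_true, h3, Fin.eta, Equiv.apply_symm_apply]
      omega

/-! The map is an order embedding because reflection in the antidiagonal preserves chute moves: it
fixes the southwest and northeast corners of the rectangle and exchanges the other two
(`ChuteMove.triforce`, `ChuteMove.of_triforce`). It lands in the right set because reflection
reverses both the labels and the direction of the pipes (`triforce_mem_PD_iff`).

The endpoints are the images of a least and a greatest element of `PD w`. A reduced pipe dream that
is not left-justified admits a chute move, moves stay inside `PD w` and increase the bounded
`rowSum`, and `PD w` contains only one left-justified element; this gives `exists_greatest`.
Transposition maps `PD w` to `PD w⁻¹` and reverses chute moves, which gives `exists_least`.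

The image is the whole interval for two reasons. Since `triforcePerm w` fixes the first `n` letters,
its reduced pipe dreams have no cross in the first `n` antidiagonals. Since a chute move carries a
cross to the southwest, the bound `n` on columns passes upwards from the least image and the bound
`n` on rows passes downwards from the greatest. The crosses of an element of the interval thus lie
in the triangle filled by the map (`exists_triforcePD_eq`). The same argument shows that chains of
moves between images stay among images, so order is reflected as well.

Pipes are handled through edge labels. By `mem_PD_iff`, membership in `PD w` means that the top
labels spell `w` and that at every cross the west label is smaller than the south label. -/

namespace PipeDream

/-! ### Cross tiles -/

/-- The box `(i, j)` contains a cross tile. -/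
def IsCross {n : ℕ} (P : PipeDream n) (i j : ℕ) : Prop := P.HasTile Tile.cross i j

theorem IsCross.lt {n : ℕ} {P : PipeDream n} {i j : ℕ} (h : P.IsCross i j) : i + j + 1 < n := by
  obtain ⟨h1, h2⟩ := h
  have := (P.elbow_iff ⟨(i, j), h1⟩).not.1 (by rw [h2]; simp)
  simp only at this
  omega

theorem hasTile_elbow_iff {n : ℕ} {P : PipeDream n} {i j : ℕ} :
    P.HasTile Tile.elbow i j ↔ i + j + 1 = n :=
  ⟨fun ⟨h, h'⟩ => (P.elbow_iff ⟨(i, j), h⟩).1 h',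
    fun h => ⟨by omega, (P.elbow_iff ⟨(i, j), by omega⟩).2 h⟩⟩

theorem hasTile_bump_iff {n : ℕ} {P : PipeDream n} {i j : ℕ} :
    P.HasTile Tile.bump i j ↔ i + j + 1 < n ∧ ¬ P.IsCross i j := by
  constructor
  · rintro ⟨h1, h2⟩
    have := (P.elbow_iff ⟨(i, j), h1⟩).not.1 (by rw [h2]; simp)
    simp only at this
    refine ⟨by omega, ?_⟩
    rintro ⟨_, h3⟩
    rw [h2] at h3
    cases h3
  · rintro ⟨h1, h2⟩
    have h3 : i + j < n := by omega
    refine ⟨h3, ?_⟩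
    have h4 := (P.elbow_iff ⟨(i, j), h3⟩).not.2 (by simp only; omega)
    have h5 : P.tile ⟨(i, j), h3⟩ ≠ Tile.cross := fun h => h2 ⟨h3, h⟩
    cases h6 : P.tile ⟨(i, j), h3⟩
    · exact (h4 h6).elim
    · exact (h5 h6).elim
    · rfl

theorem ext_isCross {n : ℕ} {P P' : PipeDream n} (h : ∀ i j, P.IsCross i j ↔ P'.IsCross i j) :
    P = P' := by
  ext ⟨⟨i, j⟩, hb⟩
  simp only at hb
  by_cases he : i + j + 1 = n
  · obtain ⟨_, h1⟩ := (hasTile_elbow_iff (P := P)).2 he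
    obtain ⟨_, h2⟩ := (hasTile_elbow_iff (P := P')).2 he
    rw [h1, h2]
  · by_cases hc : P.IsCross i j
    · obtain ⟨_, h2⟩ := (h i j).1 hc
      obtain ⟨_, h1⟩ := hc
      rw [h1, h2]
    · obtain ⟨_, h1⟩ := (hasTile_bump_iff (P := P)).2 ⟨by omega, hc⟩
      obtain ⟨_, h2⟩ := (hasTile_bump_iff (P := P')).2 ⟨by omega, mt (h i j).2 hc⟩
      rw [h1, h2]

open Classical in
/-- The pipe dream whose cross tiles off the southeast boundary are prescribed. -/
noncomputable def ofCross (n : ℕ) (X : ℕ → ℕ → Prop) : PipeDream n where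
  tile b := if b.1.1 + b.1.2 + 1 = n then Tile.elbow else if X b.1.1 b.1.2 then Tile.cross
    else Tile.bump
  elbow_iff b := by
    by_cases h : b.1.1 + b.1.2 + 1 = n
    · simp [h]
    · by_cases h' : X b.1.1 b.1.2 <;> simp [h, h']

theorem isCross_ofCross {n : ℕ} {X : ℕ → ℕ → Prop} {i j : ℕ} :
    (ofCross n X).IsCross i j ↔ i + j + 1 < n ∧ X i j := by
  constructor
  · intro h
    have hl := h.lt
    refine ⟨hl, ?_⟩
    obtain ⟨h1, h2⟩ := h
    by_contra hX
    simp [ofCross, hX, hl.ne] at h2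
  · rintro ⟨h1, h2⟩
    exact ⟨by omega, by simp [ofCross, h1.ne, h2]⟩

theorem isCross_triforce {n : ℕ} {P : PipeDream n} {i j : ℕ} :
    P.triforce.IsCross i j ↔ i < n ∧ j < n ∧ P.IsCross (n - 1 - j) (n - 1 - i) := by
  constructor
  · intro h
    have hl := h.lt
    obtain ⟨h1, h2⟩ := h
    by_cases h3 : i < n ∧ j < n ∧ n ≤ i + j
    · refine ⟨h3.1, h3.2.1, by omega, ?_⟩
      simpa [triforce, hl.ne, h3] using h2
    · simp [triforce, hl.ne, h3] at h2
  · rintro ⟨h1, h2, h3⟩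
    have hl := h3.lt
    obtain ⟨h4, h5⟩ := h3
    have h6 : n ≤ i + j := by omega
    have h7 : i + j + 1 ≠ 2 * n := by omega
    exact ⟨by omega, by simpa [triforce, h1, h2, h6, h7] using h5⟩

/-- The crosses determine a pipe dream, so bump and elbow need not be told apart: both are
non-crosses, separated by position alone. -/
theorem chuteMove_iff {n : ℕ} {P P' : PipeDream n} : P.ChuteMove P' ↔
    ∃ r₁ r₂ c₁ c₂ : ℕ, r₁ < r₂ ∧ c₁ < c₂ ∧ r₂ + c₂ < n ∧
      ¬ P.IsCross r₁ c₁ ∧ ¬ P.IsCross r₂ c₁ ∧ ¬ P.IsCross r₂ c₂ ∧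
      (∀ i j : ℕ, r₁ ≤ i → i ≤ r₂ → c₁ ≤ j → j ≤ c₂ →
        (i, j) ≠ (r₁, c₁) → (i, j) ≠ (r₂, c₁) → (i, j) ≠ (r₂, c₂) → P.IsCross i j) ∧
      ∀ i j, P'.IsCross i j ↔ (P.IsCross i j ∧ (i, j) ≠ (r₁, c₂)) ∨ (i, j) = (r₂, c₁) := by
  constructor
  · rintro ⟨r₁, r₂, c₁, c₂, hr, hc, h1, h2, h3, h4, h5, h6, h7⟩
    refine ⟨r₁, r₂, c₁, c₂, hr, hc, ?_, (hasTile_bump_iff.1 h1).2, (hasTile_bump_iff.1 h2).2, ?_,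
      h4, ?_⟩
    · rcases h3 with ⟨h, -⟩ | ⟨h, -⟩ <;> exact h
    · rcases h3 with h | h
      · exact (hasTile_bump_iff.1 h).2
      · exact fun h' => by have := h'.lt; have := hasTile_elbow_iff.1 h; omega
    · intro i j
      by_cases e1 : (i, j) = (r₂, c₁)
      · obtain ⟨rfl, rfl⟩ := Prod.mk.inj e1
        exact iff_of_true h5 (Or.inr rfl)
      by_cases e2 : (i, j) = (r₁, c₂)
      · obtain ⟨rfl, rfl⟩ := Prod.mk.inj e2
        simpa [e1] using (hasTile_bump_iff.1 h6).2
      simp only [e1, e2, or_false, ne_eq, not_false_eq_true, and_true]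
      exact exists_congr fun h => by rw [h7 ⟨(i, j), h⟩ e1 e2]
  · rintro ⟨r₁, r₂, c₁, c₂, hr, hc, hn, h1, h2, h3, h4, h5⟩
    have h6 : P'.IsCross r₂ c₁ := (h5 _ _).2 (Or.inr rfl)
    have h7 : ¬ P'.IsCross r₁ c₂ := by rw [h5]; simp; omega
    refine ⟨r₁, r₂, c₁, c₂, hr, hc, hasTile_bump_iff.2 ⟨by omega, h1⟩,
      hasTile_bump_iff.2 ⟨by omega, h2⟩, ?_, h4, h6, hasTile_bump_iff.2 ⟨by omega, h7⟩, ?_⟩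
    · by_cases he : r₂ + c₂ + 1 = n
      · exact Or.inr (hasTile_elbow_iff.2 he)
      · exact Or.inl (hasTile_bump_iff.2 ⟨by omega, h3⟩)
    · rintro ⟨⟨i, j⟩, hb⟩ e1 e2
      simp only at e1 e2 hb
      have h8 : P'.IsCross i j ↔ P.IsCross i j := by rw [h5]; simp [e1, e2]
      by_cases he : i + j + 1 = n
      · obtain ⟨_, h1⟩ := (hasTile_elbow_iff (P := P)).2 he
        obtain ⟨_, h2⟩ := (hasTile_elbow_iff (P := P')).2 he
        rw [h1, h2]
      · by_cases hc : P.IsCross i j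
        · obtain ⟨_, h2⟩ := h8.2 hc
          obtain ⟨_, h1⟩ := hc
          rw [h1, h2]
        · obtain ⟨_, h1⟩ := (hasTile_bump_iff (P := P)).2 ⟨by omega, hc⟩
          obtain ⟨_, h2⟩ := (hasTile_bump_iff (P := P')).2 ⟨by omega, mt h8.1 hc⟩
          rw [h1, h2]

/-! ### Labellings of the edges -/

/-- `H i j` is the label of the pipe on the west side of box `(i, j)`, and `V i j` is the label of
the pipe on the north side of box `(i, j)`. -/
structure IsLabelling {n : ℕ} (P : PipeDream n) (H V : ℕ → ℕ → ℕ) : Prop where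
  start : ∀ i < n, H i 0 = i
  cross_east : ∀ i j, P.IsCross i j → H i (j + 1) = H i j
  cross_north : ∀ i j, P.IsCross i j → V i j = V (i + 1) j
  bump_east : ∀ i j, i + j + 1 < n → ¬ P.IsCross i j → H i (j + 1) = V (i + 1) j
  turn_north : ∀ i j, i + j < n → ¬ P.IsCross i j → V i j = H i j

/-- Induction along the pipes: from the west side to the north side of the staircase. -/
theorem edge_induction {n : ℕ} {p q : ℕ → ℕ → Prop} (start : ∀ i < n, p i 0)
    (north : ∀ i j, i + j < n → p i j → (i + j + 1 < n → q (i + 1) j) → q i j)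
    (east : ∀ i j, i + j + 1 < n → p i j → q (i + 1) j → p i (j + 1)) :
    ∀ j i, i + j < n → p i j ∧ q i j := by
  -- Each column is climbed from its boundary box; `d` is the distance to that box, where no south
  -- edge is needed.
  have col : ∀ j, (∀ i, i + j < n → p i j) → ∀ d i, i + j + d + 1 = n → q i j := by
    intro j hj d
    induction d with
    | zero => exact fun i hi => north i j (by omega) (hj i (by omega)) fun h => by omega
    | succ d ih =>
      exact fun i hi => north i j (by omega) (hj i (by omega)) fun h => ih (i + 1) (by omega)
  have main : ∀ j i, i + j < n → p i j := by
    intro j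
    induction j with
    | zero => exact fun i hi => start i hi
    | succ j ih =>
      exact fun i hi => east i j hi (ih i (by omega)) (col j ih (n - (i + 1 + j + 1)) _ (by omega))
  exact fun j i h => ⟨main j i h, col j (main j) (n - (i + j + 1)) i (by omega)⟩

/-- The local rules determine all labels in the staircase, so an explicit guess may replace the
labelling built from `frontier`. -/
theorem IsLabelling.eq {n : ℕ} {P : PipeDream n} {H V H' V' : ℕ → ℕ → ℕ} (h : P.IsLabelling H V)
    (h' : P.IsLabelling H' V') : ∀ j i, i + j < n → H i j = H' i j ∧ V i j = V' i j := by
  apply edge_induction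
  · intro i hi
    rw [h.start i hi, h'.start i hi]
  · intro i j hij hp hq
    by_cases hc : P.IsCross i j
    · rw [h.cross_north i j hc, h'.cross_north i j hc, hq hc.lt]
    · rw [h.turn_north i j hij hc, h'.turn_north i j hij hc, hp]
  · intro i j hij hp hq
    by_cases hc : P.IsCross i j
    · rw [h.cross_east i j hc, h'.cross_east i j hc, hp]
    · rw [h.bump_east i j hij hc, h'.bump_east i j hij hc, hq]

/-! ### Translation between pipes and edge labels -/

theorem IsLabelling.of_enters {n : ℕ} {P : PipeDream n} {H V : ℕ → ℕ → ℕ} (h : P.IsLabelling H V)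
    {p : Fin n} {s : Side} {i j : ℕ} (he : P.Enters p s i j) :
    (s = Side.west → H i j = p) ∧ (s = Side.south → V (i + 1) j = p) := by
  induction he with
  | start => exact ⟨fun _ => h.start _ p.2, by simp⟩
  | cross_east _ hc ih => exact ⟨fun _ => (h.cross_east _ _ hc).trans (ih.1 rfl), by simp⟩
  | cross_north _ hc ih => exact ⟨by simp, fun _ => (h.cross_north _ _ hc).trans (ih.2 rfl)⟩
  | bump_north _ hc ih =>
    rw [hasTile_bump_iff] at hc
    exact ⟨by simp, fun _ => (h.turn_north _ _ (by omega) hc.2).trans (ih.1 rfl)⟩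
  | bump_east _ hc ih =>
    rw [hasTile_bump_iff] at hc
    exact ⟨fun _ => (h.bump_east _ _ hc.1 hc.2).trans (ih.2 rfl), by simp⟩
  | elbow_north _ hc ih =>
    rw [hasTile_elbow_iff] at hc
    exact ⟨by simp, fun _ => (h.turn_north _ _ (by omega) fun h => by have := h.lt; omega).trans
      (ih.1 rfl)⟩

theorem IsLabelling.exists_enters {n : ℕ} {P : PipeDream n} {H V : ℕ → ℕ → ℕ}
    (h : P.IsLabelling H V) : ∀ j i, i + j < n →
      (∃ p : Fin n, H i j = p ∧ P.Enters p Side.west i j) ∧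
      (∃ p : Fin n, V i j = p ∧ ∀ k, i = k + 1 → P.Enters p Side.south k j) := by
  apply edge_induction
  · exact fun i hi => ⟨⟨i, hi⟩, h.start i hi, Enters.start⟩
  · rintro i j hij ⟨p, hp, hpe⟩ hq
    by_cases hc : P.IsCross i j
    · obtain ⟨q, hq, hqe⟩ := hq hc.lt
      refine ⟨q, (h.cross_north i j hc).trans hq, ?_⟩
      rintro k rfl
      exact Enters.cross_north (hqe _ rfl) hc
    · refine ⟨p, (h.turn_north i j hij hc).trans hp, ?_⟩
      rintro k rfl
      by_cases he : k + 1 + j + 1 = n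
      · exact Enters.elbow_north hpe (hasTile_elbow_iff.2 he)
      · exact Enters.bump_north hpe (hasTile_bump_iff.2 ⟨by omega, hc⟩)
  · rintro i j hij ⟨p, hp, hpe⟩ ⟨q, hq, hqe⟩
    by_cases hc : P.IsCross i j
    · exact ⟨p, (h.cross_east i j hc).trans hp, Enters.cross_east hpe hc⟩
    · exact ⟨q, (h.bump_east i j hij hc).trans hq,
        Enters.bump_east (hqe _ rfl) (hasTile_bump_iff.2 ⟨hij, hc⟩)⟩

theorem IsLabelling.enters_west_iff {n : ℕ} {P : PipeDream n} {H V : ℕ → ℕ → ℕ}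
    (h : P.IsLabelling H V) {p : Fin n} {i j : ℕ} (hij : i + j < n) :
    P.Enters p Side.west i j ↔ H i j = p := by
  refine ⟨fun he => (h.of_enters he).1 rfl, fun he => ?_⟩
  obtain ⟨⟨q, hq, hqe⟩, -⟩ := h.exists_enters j i hij
  rwa [show p = q from Fin.ext (he.symm.trans hq)]

theorem IsLabelling.enters_south_iff {n : ℕ} {P : PipeDream n} {H V : ℕ → ℕ → ℕ}
    (h : P.IsLabelling H V) {p : Fin n} {i j : ℕ} (hij : i + j + 1 < n) :
    P.Enters p Side.south i j ↔ V (i + 1) j = p := by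
  refine ⟨fun he => (h.of_enters he).2 rfl, fun he => ?_⟩
  obtain ⟨-, q, hq, hqe⟩ := h.exists_enters j (i + 1) (by omega)
  rw [show p = q from Fin.ext (he.symm.trans hq)]
  exact hqe i rfl

theorem IsLabelling.isFor_iff {n : ℕ} {P : PipeDream n} {H V : ℕ → ℕ → ℕ}
    (h : P.IsLabelling H V) {w : Equiv.Perm (Fin n)} :
    P.IsFor w ↔ ∀ j : Fin n, V 0 j = w j := by
  refine forall_congr' fun j => ?_
  unfold ExitsAt
  rw [hasTile_bump_iff, hasTile_elbow_iff, h.enters_west_iff (by simp)]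
  by_cases hc : P.IsCross 0 j
  · have hl := hc.lt
    rw [h.enters_south_iff hl, h.cross_north _ _ hc]
    simp only [hc, show P.HasTile Tile.cross 0 j from hc]
    simp; omega
  · rw [h.turn_north _ _ (by simp) hc]
    have : ¬ P.HasTile Tile.cross 0 j := hc
    have := j.2
    simp only [*]
    simp; omega

theorem IsLabelling.crossAt_iff {n : ℕ} {P : PipeDream n} {H V : ℕ → ℕ → ℕ}
    (h : P.IsLabelling H V) {p q : Fin n} {i j : ℕ} :
    P.CrossAt p q i j ↔ P.IsCross i j ∧
      ((H i j = p ∧ V (i + 1) j = q) ∨ (H i j = q ∧ V (i + 1) j = p)) := by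
  refine and_congr_right fun hc => ?_
  have hl := IsCross.lt hc
  rw [h.enters_west_iff (by omega), h.enters_west_iff (by omega), h.enters_south_iff hl,
    h.enters_south_iff hl]

/-! ### The sequence of labels on a moving frontier -/

open Classical in
/-- The labels on the frontier after the first `t` boxes have been read, columnwise from left to
right and in each column from bottom to top. -/
noncomputable def frontier {n : ℕ} (P : PipeDream n) : ℕ → Equiv.Perm ℕ
  | 0 => 1
  | t + 1 => if P.IsCross (n - 1 - t % n) (t / n) then
      P.frontier t * Equiv.swap (n - 1 - t % n + t / n) (n - 1 - t % n + t / n + 1)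
    else P.frontier t

/-- The number of boxes that are read before box `(i, j)`. -/
def time (n i j : ℕ) : ℕ := j * n + (n - 1 - i)

theorem row_time {n i : ℕ} (j : ℕ) (hi : i < n) : n - 1 - time n i j % n = i := by
  rw [time, mul_comm, Nat.mul_add_mod, Nat.mod_eq_of_lt (by omega)]
  omega

theorem col_time {n i : ℕ} (j : ℕ) (hi : i < n) : time n i j / n = j := by
  rw [time, mul_comm, Nat.mul_add_div (by omega), Nat.div_eq_of_lt (by omega), add_zero]

theorem time_row_col {n t : ℕ} (hn : 0 < n) : time n (n - 1 - t % n) (t / n) = t := by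
  have h := Nat.mod_lt t hn
  have h' := Nat.div_add_mod' t n
  rw [time]
  omega

theorem time_lt_time {n i j i' j' : ℕ} (hi : i < n) (hi' : i' < n) :
    time n i j < time n i' j' ↔ j < j' ∨ (j = j' ∧ i' < i) := by
  unfold time
  rcases lt_trichotomy j j' with h | h | h
  · have : (j + 1) * n ≤ j' * n := Nat.mul_le_mul_right n h
    rw [add_mul] at this
    omega
  · subst h
    omega
  · have : (j' + 1) * n ≤ j * n := Nat.mul_le_mul_right n h
    rw [add_mul] at this
    omega

theorem frontier_succ_cross {n : ℕ} {P : PipeDream n} {i j : ℕ} (h : P.IsCross i j) :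
    P.frontier (time n i j + 1) = P.frontier (time n i j) * Equiv.swap (i + j) (i + j + 1) := by
  have hl := h.lt
  rw [frontier, row_time j (by omega), col_time j (by omega), if_pos h]

theorem frontier_succ_not_cross {n : ℕ} {P : PipeDream n} {i j : ℕ} (hi : i < n)
    (h : ¬ P.IsCross i j) : P.frontier (time n i j + 1) = P.frontier (time n i j) := by
  rw [frontier, row_time j hi, col_time j hi, if_neg h]

theorem frontier_apply_eq {n : ℕ} {P : PipeDream n} {t t' x : ℕ} (ht : t ≤ t')
    (h : ∀ i j, P.IsCross i j → t ≤ time n i j → time n i j < t' → x ≠ i + j ∧ x ≠ i + j + 1) :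
    P.frontier t' x = P.frontier t x := by
  induction t', ht using Nat.le_induction with
  | base => rfl
  | succ s hs ih =>
    rw [← ih fun i j hc h1 h2 => h i j hc h1 (by omega), frontier]
    split_ifs with hc
    · have hl := hc.lt
      have hts := time_row_col (n := n) (t := s) ((Nat.zero_le _).trans_lt hl)
      obtain ⟨h1, h2⟩ := h _ _ hc (by rw [hts]; exact hs) (by rw [hts]; exact s.lt_succ_self)
      rw [Equiv.Perm.mul_apply, Equiv.swap_apply_of_ne_of_ne h1 h2]
    · rfl

/-- Just before box `(i, j)` is read, positions `i + j` and `i + j + 1` of the frontier are its west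
and south edges; a cross exchanges their labels. Writing `n - i` in the second function makes it
refer to the moment just before the box above row `i` is read. -/
theorem isLabelling_frontier {n : ℕ} (P : PipeDream n) :
    P.IsLabelling (fun i j => P.frontier (time n i j) (i + j))
      (fun i j => P.frontier (j * n + (n - i)) (i + j)) := by
  have hV : ∀ i j, j * n + (n - (i + 1)) = time n i j := fun i j => by unfold time; omega
  have hV' : ∀ i j, i < n → j * n + (n - i) = time n i j + 1 := fun i j h => by unfold time; omega
  -- Between box `(i, j)` and its east neighbour, no box that is read touches the edge they share.
  have east : ∀ i j, i + j + 1 < n → P.frontier (time n i (j + 1)) (i + j + 1) =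
      P.frontier (time n i j + 1) (i + j + 1) := by
    intro i j hij
    refine frontier_apply_eq ((time_lt_time (by omega) (by omega)).2 (Or.inl (by omega))) ?_
    intro i' j' hc h1 h2
    have hl := hc.lt
    rw [Nat.succ_le_iff, time_lt_time (by omega) (by omega)] at h1
    rw [time_lt_time (by omega) (by omega)] at h2
    omega
  constructor
  · intro i hi
    refine (frontier_apply_eq (Nat.zero_le _) ?_).trans ?_
    · intro i' j' hc h1 h2
      have hl := hc.lt
      rw [time_lt_time (by omega) (by omega)] at h2
      omega
    · simp [frontier]
  · intro i j hc
    have hl := hc.lt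
    rw [← add_assoc, east i j hl, frontier_succ_cross hc, Equiv.Perm.mul_apply, Equiv.swap_apply_right]
  · intro i j hc
    have hl := hc.lt
    rw [hV, hV' i j (by omega), frontier_succ_cross hc, Equiv.Perm.mul_apply,
      Equiv.swap_apply_left, add_right_comm]
  · intro i j hij hc
    rw [← add_assoc, hV, east i j hij, frontier_succ_not_cross (by omega) hc, add_right_comm i 1 j]
  · intro i j hij hc
    rw [hV' i j (by omega), frontier_succ_not_cross (by omega) hc]

/-! ### Inversions -/

theorem swap_lt_swap_iff {k a b : ℕ} (h : ¬ (a = k ∧ b = k + 1))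
    (h' : ¬ (a = k + 1 ∧ b = k)) :
    Equiv.swap k (k + 1) a < Equiv.swap k (k + 1) b ↔ a < b := by
  simp only [Equiv.swap_apply_def]
  split_ifs <;> omega

/-- The pair `p, q` has the same order before and after a box is read, unless this box contains a
crossing of `p` and `q`. -/
theorem frontier_succ_lt_iff {n : ℕ} {P : PipeDream n} {t p q : ℕ}
    (h : ∀ i j, t = time n i j → P.IsCross i j →
      ¬ (P.frontier t (i + j) = p ∧ P.frontier t (i + j + 1) = q) ∧
      ¬ (P.frontier t (i + j) = q ∧ P.frontier t (i + j + 1) = p)) :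
    (P.frontier (t + 1)).symm p < (P.frontier (t + 1)).symm q ↔
      (P.frontier t).symm p < (P.frontier t).symm q := by
  rw [frontier]
  split_ifs with hc
  · have hl := hc.lt
    obtain ⟨h1, h2⟩ := h _ _ (time_row_col ((Nat.zero_le _).trans_lt hl)).symm hc
    refine swap_lt_swap_iff ?_ ?_
    · rwa [Equiv.symm_apply_eq, Equiv.symm_apply_eq, @eq_comm _ p, @eq_comm _ q]
    · rwa [and_comm, Equiv.symm_apply_eq, Equiv.symm_apply_eq, @eq_comm _ p, @eq_comm _ q]
  · rfl

/-- At every cross tile, the pipe entering from the west has the smaller label. -/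
def IsAscending {n : ℕ} (P : PipeDream n) : Prop :=
  ∀ i j, P.IsCross i j → P.frontier (time n i j) (i + j) < P.frontier (time n i j) (i + j + 1)

/-- A cross whose west label is smaller can only create an inversion, never undo one. -/
theorem IsAscending.inverted_mono {n : ℕ} {P : PipeDream n} (h : P.IsAscending) {p q t t' : ℕ}
    (hpq : p < q) (ht : t ≤ t') (hi : (P.frontier t).symm q < (P.frontier t).symm p) :
    (P.frontier t').symm q < (P.frontier t').symm p := by
  induction t', ht using Nat.le_induction with
  | base => exact hi
  | succ s hs ih =>
    rw [frontier_succ_lt_iff]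
    · exact ih
    · rintro i j rfl hc
      have ha := h i j hc
      constructor
      · rintro ⟨rfl, rfl⟩
        omega
      · rintro ⟨rfl, rfl⟩
        simp only [Equiv.symm_apply_apply] at ih
        omega

theorem inverted_of_isCross {n : ℕ} {P : PipeDream n} {i j : ℕ} (hc : P.IsCross i j) :
    (P.frontier (time n i j + 1)).symm (P.frontier (time n i j) (i + j + 1)) <
      (P.frontier (time n i j + 1)).symm (P.frontier (time n i j) (i + j)) := by
  rw [frontier_succ_cross hc]
  change Equiv.swap _ _ (_ : ℕ) < Equiv.swap _ _ (_ : ℕ)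
  simp

theorem isReduced_iff_isAscending {n : ℕ} {P : PipeDream n} : P.IsReduced ↔ P.IsAscending := by
  have hL := P.isLabelling_frontier
  have hcr : ∀ {p q : Fin n} {i j : ℕ}, P.CrossAt p q i j ↔ P.IsCross i j ∧
      ((P.frontier (time n i j) (i + j) = p ∧ P.frontier (time n i j) (i + j + 1) = q) ∨
      (P.frontier (time n i j) (i + j) = q ∧ P.frontier (time n i j) (i + j + 1) = p)) := by
    intro p q i j
    rw [hL.crossAt_iff, show j * n + (n - (i + 1)) = time n i j by unfold time; omega,
      add_right_comm i 1 j]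
  constructor
  · intro hR i j hc
    by_contra hlt
    have hl := hc.lt
    set T := time n i j with hT
    have hne : P.frontier T (i + j) ≠ P.frontier T (i + j + 1) :=
      (P.frontier T).injective.ne (by omega)
    obtain ⟨⟨q, hq, -⟩, -⟩ := hL.exists_enters j i (by omega)
    obtain ⟨-, p, hp, -⟩ := hL.exists_enters j (i + 1) (by omega)
    rw [show j * n + (n - (i + 1)) = time n i j by unfold time; omega, add_right_comm i 1 j] at hp
    rw [← hT] at hp hq
    have hpq : p.1 < q.1 := by omega
    -- The pair is inverted at time `T`, hence it has crossed before.
    have key : ∀ t ≤ T, ¬ (P.frontier t).symm q < (P.frontier t).symm p := by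
      intro t
      induction t with
      | zero => exact fun _ => not_lt.2 hpq.le
      | succ t ih =>
        intro ht
        rw [frontier_succ_lt_iff]
        · exact ih (by omega)
        · rintro i' j' rfl hc'
          rw [← not_or]
          intro h
          obtain ⟨rfl, rfl⟩ := hR q p (Fin.ne_of_gt hpq) i j i' j' (hcr.2 ⟨hc, Or.inl ⟨hq, hp⟩⟩)
            (hcr.2 ⟨hc', h⟩)
          omega
    refine key T le_rfl ?_
    rw [← hp, ← hq]
    simp
  · intro hA p q hpq i j i' j' h h'
    -- After its first crossing the pair stays inverted, while at a second crossing the smaller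
    -- label would have to be in the earlier position.
    have key : ∀ {p q : Fin n} {i j i' j' : ℕ}, P.CrossAt p q i j → P.CrossAt p q i' j' →
        ¬ time n i j < time n i' j' := by
      intro p q i j i' j' h h' hlt
      rw [hcr] at h h'
      have h1 := hA.inverted_mono (hA i j h.1) hlt (inverted_of_isCross h.1)
      have ha := hA i j h.1
      have ha' := hA i' j' h'.1
      have hsym : (P.frontier (time n i' j')).symm (P.frontier (time n i' j') (i' + j')) <
          (P.frontier (time n i' j')).symm (P.frontier (time n i' j') (i' + j' + 1)) := by simp
      obtain ⟨-, ⟨e1, e2⟩ | ⟨e1, e2⟩⟩ := h <;> obtain ⟨-, ⟨e3, e4⟩ | ⟨e3, e4⟩⟩ := h' <;>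
        rw [e1, e2] at h1 ha <;> rw [e3, e4] at ha' hsym <;> omega
    have hl := ((hcr.1 h).1).lt
    have hl' := ((hcr.1 h').1).lt
    have h1 := key h h'
    have h2 := key h' h
    rw [time_lt_time (by omega) (by omega)] at h1 h2
    omega

/-- This turns the global condition on pairs of pipes into a test at each cross, valid for any
labelling. -/
theorem mem_PD_iff {n : ℕ} {P : PipeDream n} {H V : ℕ → ℕ → ℕ} (h : P.IsLabelling H V)
    {w : Equiv.Perm (Fin n)} : P ∈ PD w ↔
      (∀ j : Fin n, V 0 j = w j) ∧ ∀ i j, P.IsCross i j → H i j < V (i + 1) j := by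
  change _ ∧ _ ↔ _
  rw [h.isFor_iff, isReduced_iff_isAscending]
  refine and_congr_right fun _ => forall₂_congr fun i j => forall_congr' fun hc => ?_
  have hl := hc.lt
  have hL := P.isLabelling_frontier
  rw [(h.eq hL j i (by omega)).1, (h.eq hL j (i + 1) (by omega)).2,
    show j * n + (n - (i + 1)) = time n i j by unfold time; omega, add_right_comm i 1 j]

theorem exists_isLabelling {n : ℕ} {P : PipeDream n} {w : Equiv.Perm (Fin n)} (hP : P ∈ PD w) :
    ∃ H V, P.IsLabelling H V ∧ (∀ j : Fin n, V 0 j = w j) ∧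
      ∀ i j, P.IsCross i j → H i j < V (i + 1) j :=
  ⟨_, _, P.isLabelling_frontier, (mem_PD_iff P.isLabelling_frontier).1 hP⟩

/-- Pipes that cross are inverted in the permutation. -/
theorem IsLabelling.lt_of_isCross {n : ℕ} {P : PipeDream n} {H V : ℕ → ℕ → ℕ}
    (h : P.IsLabelling H V) {w : Equiv.Perm (Fin n)} (hP : P ∈ PD w) {i j : ℕ}
    (hc : P.IsCross i j) {x y : Fin n} (hx : H i j = w x) (hy : V (i + 1) j = w y) : y < x := by
  have hA : P.IsAscending := isReduced_iff_isAscending.1 hP.2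
  have hl := hc.lt
  have hL := P.isLabelling_frontier
  -- Once column `x` has been read, position `x` of the frontier is final; at time `n * n` the
  -- frontier spells `w`.
  have hw : ∀ x : Fin n, (P.frontier (n * n)).symm (w x) = x := by
    intro x
    rw [Equiv.symm_apply_eq, ← hL.isFor_iff.1 hP.1 x, zero_add]
    symm
    have hxn : (x + 1) * n ≤ n * n := Nat.mul_le_mul_right n x.2
    rw [add_mul] at hxn
    refine frontier_apply_eq (by omega) ?_
    intro i' j' hc' h1 h2
    have hl' := hc'.lt
    have : time n 0 x < time n i' j' := by
      have : time n 0 x = x * n + (n - 1) := by simp [time]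
      omega
    rw [time_lt_time (by omega) (by omega)] at this
    omega
  have hT : time n i j + 1 ≤ n * n := by
    have : (j + 1) * n ≤ n * n := Nat.mul_le_mul_right n (by omega)
    rw [add_mul] at this
    unfold time
    omega
  have h1 := hA.inverted_mono (hA i j hc) hT (inverted_of_isCross hc)
  rw [(h.eq hL j i (by omega)).1] at hx
  rw [(h.eq hL j (i + 1) (by omega)).2,
    show j * n + (n - (i + 1)) = time n i j by unfold time; omega, add_right_comm i 1 j] at hy
  rw [hx, hy, hw, hw] at h1
  exact h1

/-! ### Chute moves and transposition preserve `PD` -/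

/-- Two pipes `a` and `d` reach the southwest corner. Before the move, `a` goes up and then east,
`d` goes east and then up, and they cross in the northeast corner; afterwards they cross in the
southwest corner and exchange routes. All labels on the boundary of the rectangle survive. -/
theorem ChuteMove.mem_PD {n : ℕ} {P P' : PipeDream n} {w : Equiv.Perm (Fin n)}
    (h : P.ChuteMove P') (hP : P ∈ PD w) : P' ∈ PD w := by
  obtain ⟨H, V, hL, hw, hA⟩ := exists_isLabelling hP
  obtain ⟨r₁, r₂, c₁, c₂, hr, hc, hn, h1, h2, h3, hX, hX'⟩ := chuteMove_iff.1 h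
  simp only [ne_eq, Prod.mk.injEq] at hX hX'
  have Va : ∀ r, r₁ < r → r ≤ r₂ → V r c₁ = H r₂ c₁ := by
    intro r hr1 hr2
    induction hr2 using Nat.decreasingInduction with
    | self => exact hL.turn_north _ _ (by omega) h2
    | of_succ r hr2 ih =>
      rw [hL.cross_north _ _ (hX r c₁ hr1.le hr2.le le_rfl hc.le (by omega) (by omega) (by omega)),
        ih (by omega)]
  have Ha : ∀ c, c₁ < c → c ≤ c₂ + 1 → H r₁ c = H r₂ c₁ := by
    intro c hc1
    induction c, hc1 using Nat.le_induction with
    | base => exact fun _ => (hL.bump_east _ _ (by omega) h1).trans (Va _ (by omega) hr)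
    | succ c hc1 ih =>
      intro hc2
      rw [hL.cross_east _ _ (hX r₁ c le_rfl hr.le (by omega) (by omega) (by omega) (by omega)
        (by omega)), ih (by omega)]
  have Hd : ∀ c, c₁ < c → c ≤ c₂ → H r₂ c = V (r₂ + 1) c₁ := by
    intro c hc1
    induction c, hc1 using Nat.le_induction with
    | base => exact fun _ => hL.bump_east _ _ (by omega) h2
    | succ c hc1 ih =>
      intro hc2
      rw [hL.cross_east _ _ (hX r₂ c hr.le le_rfl (by omega) (by omega) (by omega) (by omega)
        (by omega)), ih (by omega)]
  have Vd : ∀ r, r₁ ≤ r → r ≤ r₂ → V r c₂ = V (r₂ + 1) c₁ := by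
    intro r hr1 hr2
    induction hr2 using Nat.decreasingInduction with
    | self => exact (hL.turn_north _ _ (by omega) h3).trans (Hd _ hc le_rfl)
    | of_succ r hr2 ih =>
      rw [hL.cross_north _ _ (hX r c₂ hr1 hr2.le hc.le le_rfl (by omega) (by omega) (by omega)),
        ih (by omega)]
  -- A pipe crossing the rectangle in an intermediate row meets both `a` and `d`, hence is smaller
  -- than both. Dually, `Vm` makes pipes in intermediate columns larger than both, so exchanging `a`
  -- and `d` spoils no comparison.
  have Hm : ∀ i, r₁ < i → i < r₂ → ∀ c, c₁ ≤ c → c ≤ c₂ →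
      H i c < H r₂ c₁ ∧ H i c < V (r₂ + 1) c₁ := by
    intro i hi1 hi2 c hc1 hc2
    have hi := fun c h1 h2 => hX i c hi1.le hi2.le h1 h2 (by omega) (by omega) (by omega)
    have e : ∀ c, c₁ ≤ c → c ≤ c₂ → H i c = H i c₁ := by
      intro c hc1
      induction c, hc1 using Nat.le_induction with
      | base => exact fun _ => rfl
      | succ c hc1 ih =>
        intro hc2
        rw [hL.cross_east _ _ (hi c hc1 (by omega)), ih (by omega)]
    have a1 := hA i c₁ (hi _ le_rfl hc.le)
    have a2 := hA i c₂ (hi _ hc.le le_rfl)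
    rw [Va _ (by omega) hi2] at a1
    rw [Vd _ (by omega) hi2, e _ hc.le le_rfl] at a2
    rw [e c hc1 hc2]
    exact ⟨a1, a2⟩
  have Vm : ∀ j, c₁ < j → j < c₂ → ∀ r, r₁ < r → r ≤ r₂ + 1 →
      H r₂ c₁ < V r j ∧ V (r₂ + 1) c₁ < V r j := by
    intro j hj1 hj2 r hr1 hr2
    have hj := fun r h1 h2 => hX r j h1 h2 hj1.le hj2.le (by omega) (by omega) (by omega)
    have e : ∀ r, r₁ < r → r ≤ r₂ + 1 → V r j = V (r₂ + 1) j := by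
      intro r hr1 hr2
      induction hr2 using Nat.decreasingInduction with
      | self => rfl
      | of_succ r hr2 ih =>
        rw [hL.cross_north _ _ (hj r hr1.le (by omega)), ih (by omega)]
    have a1 := hA r₁ j (hj _ le_rfl hr.le)
    have a2 := hA r₂ j (hj _ hr.le le_rfl)
    rw [Ha _ hj1 (by omega), e _ (by omega) (by omega)] at a1
    rw [Hd _ hj1 hj2.le] at a2
    rw [e r hr1 hr2]
    exact ⟨a1, a2⟩
  have had : H r₂ c₁ < V (r₂ + 1) c₁ := by
    have := hA r₁ c₂ (hX r₁ c₂ le_rfl hr.le hc.le le_rfl (by omega) (by omega) (by omega))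
    rwa [Ha _ hc (by omega), Vd _ (by omega) hr] at this
  -- The labels `a` and `d` are exchanged in the interior of the rectangle.
  set a := H r₂ c₁ with ha
  set d := V (r₂ + 1) c₁ with hd
  let H' : ℕ → ℕ → ℕ := fun i j =>
    if c₁ < j ∧ j ≤ c₂ then if i = r₁ then d else if i = r₂ then a else H i j else H i j
  let V' : ℕ → ℕ → ℕ := fun i j =>
    if r₁ < i ∧ i ≤ r₂ then if j = c₁ then d else if j = c₂ then a else V i j else V i j
  have hL' : P'.IsLabelling H' V' := by
    constructor
    · intro i hi
      simp only [H', Nat.not_lt_zero, false_and, if_false]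
      exact hL.start i hi
    · intro i j
      have := hX i j
      have := hX' i j
      have := hL.cross_east i j
      have := Ha j
      have := Ha (j + 1)
      have := Hd j
      have := Hd (j + 1)
      simp only [H']
      grind
    · intro i j
      have := hX i j
      have := hX' i j
      have := hL.cross_north i j
      have := Va i
      have := Va (i + 1)
      have := Vd i
      have := Vd (i + 1)
      simp only [V']
      grind
    · intro i j
      have := hX i j
      have := hX' i j
      have := hL.cross_east i j
      have := hL.bump_east i j
      have := Ha j
      have := Ha (j + 1)
      have := Hd j
      have := Hd (j + 1)
      have := Va i
      have := Va (i + 1)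
      have := Vd i
      have := Vd (i + 1)
      simp only [H', V']
      grind
    · intro i j
      have := hX i j
      have := hX' i j
      have := hL.cross_north i j
      have := hL.turn_north i j
      have := Ha j
      have := Hd j
      have := Va i
      have := Va (i + 1)
      have := Vd i
      have := Vd (i + 1)
      simp only [H', V']
      grind
  rw [mem_PD_iff hL']
  refine ⟨fun j => by simp [V', hw], fun i j => ?_⟩
  have := hX i j
  have := hX' i j
  have := hA i j
  have := Va (i + 1)
  have := Vd (i + 1)
  have := Ha j
  have := Hd j
  have := Hm i
  have := Vm j
  simp only [H', V']
  grind

/-- The reflection of a pipe dream that exchanges rows and columns. -/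
noncomputable def transpose {n : ℕ} (P : PipeDream n) : PipeDream n :=
  ofCross n fun i j => P.IsCross j i

theorem isCross_transpose {n : ℕ} {P : PipeDream n} {i j : ℕ} :
    P.transpose.IsCross i j ↔ P.IsCross j i :=
  isCross_ofCross.trans ⟨fun h => h.2, fun h => ⟨by have := h.lt; omega, h⟩⟩

theorem transpose_transpose {n : ℕ} (P : PipeDream n) : P.transpose.transpose = P :=
  ext_isCross fun _ _ => isCross_transpose.trans isCross_transpose

/-- Transposition runs every pipe backwards, so its new label is the column where it used to exit.
Crossing pipes are inverted in `w` (`IsLabelling.lt_of_isCross`), which is the required comparison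
of the new labels. -/
theorem transpose_mem_PD {n : ℕ} {P : PipeDream n} {w : Equiv.Perm (Fin n)} (hP : P ∈ PD w) :
    P.transpose ∈ PD w⁻¹ := by
  obtain ⟨H, V, hL, hw, hA⟩ := exists_isLabelling hP
  let g : ℕ → ℕ := fun x => if h : x < n then w.symm ⟨x, h⟩ else 0
  have hg : ∀ x : Fin n, g (w x) = x := fun x => by simp [g]
  have hL' : P.transpose.IsLabelling (fun i j => g (V j i)) (fun i j => g (H j i)) := by
    constructor
    · exact fun i hi => by simpa [hw ⟨i, hi⟩] using hg ⟨i, hi⟩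
    · intro i j hc
      rw [isCross_transpose] at hc
      rw [hL.cross_north _ _ hc]
    · intro i j hc
      rw [isCross_transpose] at hc
      rw [hL.cross_east _ _ hc]
    · intro i j hij hc
      rw [isCross_transpose] at hc
      rw [hL.bump_east _ _ (by omega) hc]
    · intro i j hij hc
      rw [isCross_transpose] at hc
      rw [hL.turn_north _ _ (by omega) hc]
  rw [mem_PD_iff hL']
  constructor
  · intro j
    simp only [hL.start j j.2]
    simp [g]
  · intro i j hc
    rw [isCross_transpose] at hc
    have hl := hc.lt
    obtain ⟨⟨p, hp, -⟩, -⟩ := hL.exists_enters i j (by omega)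
    obtain ⟨-, q, hq, -⟩ := hL.exists_enters i (j + 1) (by omega)
    have := hL.lt_of_isCross hP hc (x := w.symm p) (y := w.symm q) (by simpa using hp)
      (by simpa using hq)
    rw [hL.cross_north _ _ hc, hL.cross_east _ _ hc, hp, hq]
    simpa [g] using this

/-- Transposition exchanges the northeast and southwest corners, hence the state before the move
with the state after it. -/
theorem ChuteMove.transpose {n : ℕ} {P P' : PipeDream n} (h : P.ChuteMove P') :
    P'.transpose.ChuteMove P.transpose := by
  obtain ⟨r₁, r₂, c₁, c₂, hr, hc, hn, h1, h2, h3, hX, hX'⟩ := chuteMove_iff.1 h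
  rw [chuteMove_iff]
  refine ⟨c₁, c₂, r₁, r₂, hc, hr, by omega, ?_⟩
  simp only [isCross_transpose, ne_eq, Prod.mk.injEq] at hX hX' ⊢
  refine ⟨?_, ?_, ?_, ?_, ?_⟩
  · rw [hX']
    rintro (h | h)
    · exact h1 h.1
    · omega
  · rw [hX']; omega
  · rw [hX']
    rintro (h | h)
    · exact h3 h.1
    · omega
  · intro i j h4 h5 h6 h7 h8 h9 h10
    rw [hX']
    by_cases e : j = r₂ ∧ i = c₁
    · exact Or.inr e
    · exact Or.inl ⟨hX j i h6 h7 h4 h5 (by omega) (by omega) (by omega), by omega⟩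
  · intro i j
    rw [hX']
    by_cases e : j = r₂ ∧ i = c₁
    · obtain ⟨rfl, rfl⟩ := e
      simp [h2]
      omega
    · by_cases e' : j = r₁ ∧ i = c₂
      · have : P.IsCross r₁ c₂ := hX r₁ c₂ le_rfl hr.le hc.le le_rfl (by omega) (by omega) (by omega)
        simp [e', this]
      · have h1 : ¬ (i = c₂ ∧ j = r₁) := by omega
        have h2 : ¬ (i = c₁ ∧ j = r₂) := by omega
        simp only [e, e', h1, h2, or_false, not_false_eq_true, and_true]

/-! ### Left-justified pipe dreams -/

/-- In every row the cross tiles precede the other tiles. -/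
def IsLeftJustified {n : ℕ} (P : PipeDream n) : Prop :=
  ∀ i j, P.IsCross i (j + 1) → P.IsCross i j

theorem exists_not_isCross {n : ℕ} (P : PipeDream n) (i j : ℕ) :
    ∃ k, i < k ∧ ¬ P.IsCross k j ∧ ∀ s, i < s → s < k → P.IsCross s j := by
  classical
  have h : ∃ k, i < k ∧ ¬ P.IsCross k j :=
    ⟨n + i + 1, by omega, fun h => by have := h.lt; omega⟩
  exact ⟨Nat.find h, (Nat.find_spec h).1, (Nat.find_spec h).2, fun s hs hs' => by
    have := Nat.find_min h hs'
    tauto⟩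

/-- Compare the first non-crosses `k` and `r` below row `i` in columns `j` and `j + 1`. If they
agree, they bound a chute rectangle two columns wide; if `k < r`, the same situation recurs in row
`k`. -/
theorem exists_chuteMove {n : ℕ} {P : PipeDream n} {w : Equiv.Perm (Fin n)} (hP : P ∈ PD w)
    {i j : ℕ} (h1 : ¬ P.IsCross i j) (h2 : P.IsCross i (j + 1)) : ∃ P', P.ChuteMove P' := by
  obtain ⟨H, V, hL, hw, hA⟩ := exists_isLabelling hP
  obtain ⟨m, hm⟩ : ∃ m, n - i = m := ⟨_, rfl⟩
  induction m using Nat.strong_induction_on generalizing i with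
  | _ m ih =>
  obtain ⟨k, hik, hk, hk'⟩ := P.exists_not_isCross i j
  obtain ⟨r, hir, hr, hr'⟩ := P.exists_not_isCross i (j + 1)
  have hl := h2.lt
  rcases lt_trichotomy r k with h | rfl | h
  · exfalso
    -- The pipes crossing at `(r, j)` would meet again at `(i, j + 1)`: one runs east and then up
    -- column `j + 1`, the other runs up column `j` and then turns east.
    have hc := hk' r hir h
    have hcl := hc.lt
    have e1 : ∀ s, i < s → s ≤ r → V s (j + 1) = H r j := by
      intro s hs1 hs2
      induction hs2 using Nat.decreasingInduction with
      | self => rw [hL.turn_north _ _ (by omega) hr, hL.cross_east _ _ hc]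
      | of_succ s hs2 ih => rw [hL.cross_north _ _ (hr' s hs1 hs2), ih (by omega)]
    have e2 : ∀ s, i < s → s ≤ r + 1 → V s j = V (r + 1) j := by
      intro s hs1 hs2
      induction hs2 using Nat.decreasingInduction with
      | self => rfl
      | of_succ s hs2 ih => rw [hL.cross_north _ _ (hk' s hs1 (by omega)), ih (by omega)]
    have a1 := hA _ _ hc
    have a2 := hA _ _ h2
    rw [hL.bump_east _ _ (by omega) h1, e2 _ (by omega) (by omega), e1 _ (by omega) (by omega)]
      at a2
    omega
  · have hn : r + (j + 1) < n := by
      by_cases e : r = i + 1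
      · omega
      · have := (hr' (r - 1) (by omega) (by omega)).lt
        omega
    refine ⟨ofCross n fun x y => (P.IsCross x y ∧ (x, y) ≠ (i, j + 1)) ∨ (x, y) = (r, j),
      chuteMove_iff.2 ⟨i, r, j, j + 1, hir, by omega, hn, h1, hk, hr, ?_, ?_⟩⟩
    · simp only [ne_eq, Prod.mk.injEq]
      intro x y hx1 hx2 hy1 hy2 h4 h5 h6
      obtain rfl | rfl : y = j ∨ y = j + 1 := by omega
      · exact hk' x (by omega) (by omega)
      · by_cases e : x = i
        · rwa [e]
        · exact hr' x (by omega) (by omega)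
    · intro x y
      rw [isCross_ofCross]
      refine and_iff_right_of_imp ?_
      rintro (⟨h, -⟩ | h)
      · exact h.lt
      · obtain ⟨rfl, rfl⟩ := Prod.mk.inj h
        omega
  · have hc := hr' k hik h
    have := hc.lt
    exact ih (n - k) (by omega) hk hc rfl

/-! ### Uniqueness and existence of the left-justified pipe dream -/

theorem IsLabelling.le {n : ℕ} {P : PipeDream n} {H V : ℕ → ℕ → ℕ} (h : P.IsLabelling H V) :
    ∀ j i, i + j < n → i ≤ H i j ∧ i ≤ V i j := by
  apply edge_induction
  · exact fun i hi => (h.start i hi).ge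
  · intro i j hij hp hq
    by_cases hc : P.IsCross i j
    · have := hq hc.lt
      have := h.cross_north i j hc
      omega
    · rwa [h.turn_north i j hij hc]
  · intro i j hij hp hq
    by_cases hc : P.IsCross i j
    · rwa [h.cross_east i j hc]
    · rw [h.bump_east i j hij hc]
      omega

theorem IsLeftJustified.exists_rowLength {n : ℕ} {P : PipeDream n} (h : P.IsLeftJustified)
    (i : ℕ) : ∃ l, ∀ j, P.IsCross i j ↔ j < l := by
  classical
  have h1 : ∃ l, ¬ P.IsCross i l := ⟨n, fun h => by have := h.lt; omega⟩
  refine ⟨Nat.find h1, fun j => ⟨fun hj => ?_, fun hj => not_not.1 (Nat.find_min h1 hj)⟩⟩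
  by_contra hlt
  refine Nat.find_spec h1 ?_
  induction j, not_lt.1 hlt using Nat.le_induction with
  | base => exact hj
  | succ j hj' ih => exact ih (h i j hj) (by omega)

/-- Rows are recovered from the top. Pipe `i` runs straight through the crosses of its row and then
turns north, so the row length is the position of the letter `i` in the word above the row; deleting
that letter gives the word below. -/
theorem IsLeftJustified.eq {n : ℕ} {P P' : PipeDream n} {w : Equiv.Perm (Fin n)}
    (h : P.IsLeftJustified) (h' : P'.IsLeftJustified) (hP : P ∈ PD w) (hP' : P' ∈ PD w) :
    P = P' := by
  choose l hl using h.exists_rowLength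
  choose l' hl' using h'.exists_rowLength
  obtain ⟨H, V, hL, hw, -⟩ := exists_isLabelling hP
  obtain ⟨H', V', hL', hw', -⟩ := exists_isLabelling hP'
  have bound : ∀ {Q : PipeDream n} {m : ℕ → ℕ}, (∀ i j, Q.IsCross i j ↔ j < m i) →
      ∀ i < n, i + m i < n := by
    intro Q m hm i hi
    by_contra hlt
    have := ((hm i (m i - 1)).2 (by omega)).lt
    omega
  have east : ∀ {Q : PipeDream n} {m : ℕ → ℕ} {H V : ℕ → ℕ → ℕ}, (∀ i j, Q.IsCross i j ↔ j < m i) →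
      Q.IsLabelling H V → ∀ i < n, V i (m i) = i := by
    intro Q m H V hm hL i hi
    have hb := bound hm i hi
    rw [hL.turn_north _ _ hb (by rw [hm]; omega)]
    have : ∀ j ≤ m i, H i j = i := by
      intro j
      induction j with
      | zero => exact fun _ => hL.start i hi
      | succ j ih => exact fun hj => (hL.cross_east _ _ ((hm i j).2 hj)).trans (ih (by omega))
    exact this _ le_rfl
  have next : ∀ {Q : PipeDream n} {m : ℕ → ℕ} {H V : ℕ → ℕ → ℕ}, (∀ i j, Q.IsCross i j ↔ j < m i) →
      Q.IsLabelling H V → ∀ i j, i + j + 1 < n →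
        V (i + 1) j = if j < m i then V i j else V i (j + 1) := by
    intro Q m H V hm hL i j hij
    split_ifs with hj
    · exact (hL.cross_north _ _ ((hm i j).2 hj)).symm
    · rw [hL.turn_north i (j + 1) (by omega) (by rw [hm]; omega),
        hL.bump_east _ _ hij (by rw [hm]; omega)]
  -- In a longer row the letter `i` would come up through a cross from row `i + 1`, where all labels
  -- exceed `i`.
  have not_lt' : ∀ {Q Q' : PipeDream n} {m m' : ℕ → ℕ} {H V H' V' : ℕ → ℕ → ℕ} {i : ℕ},
      (∀ i j, Q.IsCross i j ↔ j < m i) → (∀ i j, Q'.IsCross i j ↔ j < m' i) →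
      Q.IsLabelling H V → Q'.IsLabelling H' V' → i < n → (∀ j, i + j < n → V i j = V' i j) →
      ¬ m i < m' i := by
    intro Q Q' m m' H V H' V' i hm hm' hL hL' hi hV hlt
    have hb := bound hm' i hi
    have h1 := hV (m i) (by omega)
    rw [east hm hL i hi, hL'.cross_north _ _ ((hm' _ _).2 hlt)] at h1
    have := (hL'.le (m i) (i + 1) (by omega)).2
    omega
  have key : ∀ i, (∀ j, i + j < n → V i j = V' i j) ∧ (∀ k < i, k < n → l k = l' k) := by
    intro i
    induction i with
    | zero => exact ⟨fun j hj => by rw [hw ⟨j, by omega⟩, hw' ⟨j, by omega⟩], fun k hk => by omega⟩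
    | succ i ih =>
      have hl_eq : i < n → l i = l' i := fun hi => by
        have h1 := not_lt' hl hl' hL hL' hi ih.1
        have h2 := not_lt' hl' hl hL' hL hi fun j hj => (ih.1 j hj).symm
        omega
      constructor
      · intro j hj
        rw [next hl hL i j (by omega), next hl' hL' i j (by omega), hl_eq (by omega),
          ih.1 j (by omega), ih.1 (j + 1) (by omega)]
      · intro k hk hkn
        obtain h | rfl : k < i ∨ k = i := by omega
        · exact ih.2 k h hkn
        · exact hl_eq hkn
  refine ext_isCross fun i j => ?_
  by_cases hi : i < n
  · rw [hl, hl', (key (i + 1)).2 i (by omega) hi]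
  · exact iff_of_false (fun h => by have := h.lt; omega) (fun h => by have := h.lt; omega)

/-- The one-line notation of `w` after the letters less than `i` have been deleted. -/
noncomputable def deleteLetters {n : ℕ} (w : Equiv.Perm (Fin n)) : ℕ → ℕ → ℕ
  | 0, j => if h : j < n then w ⟨j, h⟩ else n
  | i + 1, j => if j < sInf {k | deleteLetters w i k = i} then deleteLetters w i j
      else deleteLetters w i (j + 1)

theorem exists_deleteLetters_eq {n : ℕ} (w : Equiv.Perm (Fin n)) (i : ℕ) :
    ∀ x, i ≤ x → x < n → ∃ j, i + j < n ∧ deleteLetters w i j = x := by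
  induction i with
  | zero =>
    exact fun x _ hx => ⟨w.symm ⟨x, hx⟩, by simp, by simp [deleteLetters]⟩
  | succ i ih =>
    intro x hx hxn
    obtain ⟨j, hj, rfl⟩ := ih x (by omega) hxn
    obtain ⟨k, hk, hki⟩ := ih i le_rfl (by omega)
    have hm : deleteLetters w i (sInf {k | deleteLetters w i k = i}) = i :=
      Nat.sInf_mem (s := {k | deleteLetters w i k = i}) ⟨k, hki⟩
    have hle : sInf {k | deleteLetters w i k = i} ≤ k := Nat.sInf_le hki
    rcases lt_trichotomy j (sInf {k | deleteLetters w i k = i}) with h | h | h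
    · exact ⟨j, by omega, by rw [deleteLetters, if_pos h]⟩
    · rw [h, hm] at hx
      omega
    · exact ⟨j - 1, by omega, by
        rw [deleteLetters, if_neg (by omega), Nat.sub_add_cancel (by omega)]⟩

/-- Row `i` gets as many crosses as there are letters before `i` in the word left after deleting
smaller letters. The west label at these crosses is `i`, and labels from below are larger. -/
theorem exists_isLeftJustified {n : ℕ} (w : Equiv.Perm (Fin n)) :
    ∃ P ∈ PD w, P.IsLeftJustified := by
  let V := deleteLetters w
  let l : ℕ → ℕ := fun i => sInf {k | V i k = i}
  have hl : ∀ i < n, V i (l i) = i ∧ i + l i < n := by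
    intro i hi
    obtain ⟨k, hk, hki⟩ := exists_deleteLetters_eq w i i le_rfl hi
    have : l i ≤ k := Nat.sInf_le hki
    exact ⟨Nat.sInf_mem (s := {k | V i k = i}) ⟨k, hki⟩, by omega⟩
  have hV : ∀ i j, V (i + 1) j = if j < l i then V i j else V i (j + 1) := fun i j => by
    simp only [V, l]
    rw [deleteLetters]
  have hX : ∀ i j, i < n → ((ofCross n fun i j => j < l i).IsCross i j ↔ j < l i) := by
    intro i j hi
    rw [isCross_ofCross]
    have := (hl i hi).2
    omega
  have hL : (ofCross n fun i j => j < l i).IsLabelling (fun i j => if j ≤ l i then i else V i j)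
      V := by
    constructor
    · simp
    · intro i j hc
      have hlt := hc.lt
      rw [hX i j (by omega)] at hc
      rw [if_pos hc.le, if_pos (by omega)]
    · intro i j hc
      have hlt := hc.lt
      rw [hX i j (by omega)] at hc
      rw [hV, if_pos hc]
    · intro i j hij hc
      rw [hX i j (by omega)] at hc
      rw [hV, if_neg hc, if_neg (by omega)]
    · intro i j hij hc
      rw [hX i j (by omega)] at hc
      split_ifs with h
      · rw [show j = l i by omega]
        exact (hl i (by omega)).1
      · rfl
  refine ⟨_, (mem_PD_iff hL).2 ⟨fun j => ?_, fun i j hc => ?_⟩, fun i j hc => ?_⟩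
  · simp [V, deleteLetters]
  · have hlt := hc.lt
    rw [hX i j (by omega)] at hc
    have := (hL.le j (i + 1) (by omega)).2
    simp only [if_pos hc.le]
    omega
  · have hlt := hc.lt
    rw [hX i _ (by omega)] at hc ⊢
    omega

/-! ### The least and the greatest element of `PD w` -/

theorem rowSum_le {n : ℕ} (P : PipeDream n) :
    P.rowSum ≤ ∑ b ∈ Finset.range n ×ˢ Finset.range n, b.1 :=
  Finset.sum_le_sum fun b _ => by split_ifs <;> simp

theorem le_of_chuteMove {n : ℕ} {w : Equiv.Perm (Fin n)} {P P' : PD w}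
    (h : P.1.ChuteMove P'.1) : P ≤ P' :=
  Relation.ReflTransGen.single h

theorem exists_greatest {n : ℕ} (w : Equiv.Perm (Fin n)) : ∃ B : PD w, ∀ P : PD w, P ≤ B := by
  obtain ⟨B, hB, hBl⟩ := exists_isLeftJustified w
  refine ⟨⟨B, hB⟩, fun P => ?_⟩
  obtain ⟨m, hm⟩ : ∃ m, ∑ b ∈ Finset.range n ×ˢ Finset.range n, b.1 - P.1.rowSum = m := ⟨_, rfl⟩
  induction m using Nat.strong_induction_on generalizing P with
  | _ m ih =>
  by_cases hPl : P.1.IsLeftJustified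
  · exact le_of_eq (Subtype.ext (hPl.eq hBl P.2 hB))
  · simp only [IsLeftJustified, not_forall] at hPl
    obtain ⟨i, j, h1, h2⟩ := hPl
    obtain ⟨P', hP'⟩ := exists_chuteMove P.2 h2 h1
    have h3 := hP'.rowSum_lt
    have h4 := P'.rowSum_le
    exact (le_of_chuteMove (P' := ⟨P', hP'.mem_PD P.2⟩) hP').trans
      (ih _ (by simp only; omega) ⟨P', hP'.mem_PD P.2⟩ rfl)

theorem transpose_le_transpose {n : ℕ} {w : Equiv.Perm (Fin n)} {P P' : PD w} (h : P ≤ P') :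
    (⟨_, transpose_mem_PD P'.2⟩ : PD w⁻¹) ≤ ⟨_, transpose_mem_PD P.2⟩ := by
  change Relation.ReflTransGen _ _ _ at h
  induction h with
  | refl => exact le_rfl
  | tail _ h ih => exact le_trans (le_of_chuteMove h.transpose) ih

theorem exists_least {n : ℕ} (w : Equiv.Perm (Fin n)) : ∃ A : PD w, ∀ P : PD w, A ≤ P := by
  obtain ⟨v, rfl⟩ : ∃ v, w = v⁻¹ := ⟨w⁻¹, (inv_inv w).symm⟩
  obtain ⟨B, hB⟩ := exists_greatest v
  refine ⟨⟨B.1.transpose, transpose_mem_PD B.2⟩, fun P => ?_⟩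
  have hP : P.1.transpose ∈ PD v := by simpa using transpose_mem_PD P.2
  simpa only [transpose_transpose] using transpose_le_transpose (hB ⟨_, hP⟩)

/-! ### The pipe dream `P^Tri` -/

/-- In the triangle the pipes of `P` run backwards with labels `x` replaced by `2 * n - 1 - x`.
Elsewhere all tiles turn, so labels are constant along antidiagonals: the starting row before the
triangle, a reversed exit label of `P` after it. -/
theorem IsLabelling.triforce {n : ℕ} {P : PipeDream n} {H V : ℕ → ℕ → ℕ} (h : P.IsLabelling H V) :
    P.triforce.IsLabelling
      (fun i j => if i < n ∧ j ≤ n ∧ n ≤ i + j then 2 * n - 1 - V (n - j) (n - 1 - i)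
        else if j ≤ n then i + j else 2 * n - 1 - V 0 (2 * n - 1 - (i + j)))
      (fun i j => if i ≤ n ∧ j < n ∧ n ≤ i + j then 2 * n - 1 - H (n - 1 - j) (n - i)
        else if j < n then i + j else 2 * n - 1 - V 0 (2 * n - 1 - (i + j))) := by
  constructor
  · intro i hi
    rw [if_neg (by omega), if_pos (by omega), add_zero]
  · intro i j hc
    rw [isCross_triforce] at hc
    obtain ⟨hi, hj, hc⟩ := hc
    have hl := hc.lt
    rw [if_pos (by omega), if_pos (by omega), show n - (j + 1) = n - 1 - j by omega,
      h.cross_north _ _ hc, show n - 1 - j + 1 = n - j by omega]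
  · intro i j hc
    rw [isCross_triforce] at hc
    obtain ⟨hi, hj, hc⟩ := hc
    have hl := hc.lt
    rw [if_pos (by omega), if_pos (by omega), show n - (i + 1) = n - 1 - i by omega,
      ← h.cross_east _ _ hc, show n - 1 - i + 1 = n - i by omega]
  · intro i j hij hc
    rw [isCross_triforce] at hc
    by_cases hin : i < n ∧ j < n ∧ n ≤ i + (j + 1)
    · rw [if_pos (by omega), if_pos (by omega), show n - (i + 1) = n - 1 - i by omega,
        show n - (j + 1) = n - 1 - j by omega, h.turn_north _ _ (by omega) (by tauto)]
    · rw [if_neg (by omega), if_neg (c := i + 1 ≤ n ∧ _) (by omega), add_right_comm, ← add_assoc]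
      exact if_congr (by omega) rfl rfl
  · intro i j hij hc
    rw [isCross_triforce] at hc
    by_cases hin : i < n ∧ j < n ∧ n ≤ i + j
    · rw [if_pos (by omega), if_pos (by omega), show n - i = n - 1 - i + 1 by omega,
        show n - j = n - 1 - j + 1 by omega, h.bump_east _ _ (by omega) (by tauto)]
    · by_cases hi : i = n ∧ j < n
      · rw [if_pos (by omega), if_neg (by omega), if_pos (by omega), hi.1, Nat.sub_self,
          h.start _ (by omega)]
        omega
      · rw [if_neg (by omega)]
        by_cases hj : j = n
        · rw [if_neg (by omega), if_pos (by omega), hj, Nat.sub_self,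
            show 2 * n - 1 - (i + n) = n - 1 - i by omega]
        · rw [if_neg (c := i < n ∧ _) (by omega)]
          exact if_congr (by omega) rfl rfl

theorem triforcePerm_of_lt {n : ℕ} (w : Equiv.Perm (Fin n)) {i : Fin (2 * n)} (h : i.1 < n) :
    triforcePerm w i = i := by
  simp [triforcePerm, h]

theorem triforcePerm_of_le {n : ℕ} (w : Equiv.Perm (Fin n)) {i : Fin (2 * n)} (h : n ≤ i.1) :
    (triforcePerm w i).1 = 2 * n - 1 - (w ⟨2 * n - 1 - i.1, by omega⟩).1 := by
  simp [triforcePerm, not_lt.2 h]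

theorem triforce_mem_PD_iff {n : ℕ} {P : PipeDream n} {w : Equiv.Perm (Fin n)} :
    P.triforce ∈ PD (triforcePerm w) ↔ P ∈ PD w := by
  have h := P.isLabelling_frontier
  generalize (fun i j => P.frontier (time n i j) (i + j)) = H at h
  generalize (fun i j => P.frontier (j * n + (n - i)) (i + j)) = V at h
  rw [mem_PD_iff h, mem_PD_iff h.triforce]
  have hH : ∀ i j, i + j < n → H i j < n := fun i j hij => by
    obtain ⟨⟨p, hp, -⟩, -⟩ := h.exists_enters j i hij
    omega
  have hV : ∀ i j, i + j < n → V i j < n := fun i j hij => by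
    obtain ⟨-, p, hp, -⟩ := h.exists_enters j i hij
    omega
  refine and_congr ⟨fun hw j => ?_, fun hw j => ?_⟩ ⟨fun hA i j hc => ?_, fun hA i j hc => ?_⟩
  · have h1 := hw ⟨2 * n - 1 - j, by omega⟩
    have h2 := triforcePerm_of_le w (i := ⟨2 * n - 1 - j, by omega⟩) (by simp only; omega)
    have h3 : 2 * n - 1 - (2 * n - 1 - j.1) = j := by omega
    rw [h2, if_neg (by omega), if_neg (by simp only; omega)] at h1
    simp only [zero_add, h3, Fin.eta] at h1
    have := hV 0 j (by omega)
    omega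
  · rw [if_neg (by omega)]
    by_cases hj : j.1 < n
    · rw [triforcePerm_of_lt w hj, if_pos hj, zero_add]
    · rw [triforcePerm_of_le w (by omega), if_neg hj, zero_add,
        ← hw ⟨2 * n - 1 - j.1, by omega⟩]
  · have hl := hc.lt
    have h1 := hA (n - 1 - j) (n - 1 - i) (isCross_triforce.2 ⟨by omega, by omega, by
      rwa [Nat.sub_sub_self (by omega), Nat.sub_sub_self (by omega)]⟩)
    rw [if_pos (by omega), if_pos (by omega), Nat.sub_sub_self (by omega),
      Nat.sub_sub_self (by omega), show n - (n - 1 - i) = i + 1 by omega,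
      show n - (n - 1 - j + 1) = j by omega] at h1
    omega
  · rw [isCross_triforce] at hc
    obtain ⟨hi, hj, hc⟩ := hc
    have hl := hc.lt
    have h1 := hA _ _ hc
    rw [if_pos (by omega), if_pos (by omega), show n - (i + 1) = n - 1 - i by omega,
      show n - j = n - 1 - j + 1 by omega]
    have := hV (n - 1 - j + 1) (n - 1 - i) (by omega)
    omega

/-- A pipe with label `i + j < n` exits in column `i + j`. A larger pipe crossing it would have to
exit further left, but those columns belong to smaller fixed letters. Without crosses, labels stay
equal to `i + j`, which feeds the induction. -/
theorem le_of_isCross_of_triforcePerm {n : ℕ} {Q : PipeDream (2 * n)} {w : Equiv.Perm (Fin n)}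
    (hQ : Q ∈ PD (triforcePerm w)) {i j : ℕ} (hc : Q.IsCross i j) : n ≤ i + j := by
  obtain ⟨H, V, hL, hw, hA⟩ := exists_isLabelling hQ
  have not_cross : ∀ i j, i + j < n → H i j = i + j → ¬ Q.IsCross i j := by
    intro i j hij hH hc
    have hl := hc.lt
    have ha := hA i j hc
    obtain ⟨-, q, hq, -⟩ := hL.exists_enters j (i + 1) (by omega)
    have hx : triforcePerm w ⟨i + j, by omega⟩ = ⟨i + j, by omega⟩ := triforcePerm_of_lt w hij
    have hlt := hL.lt_of_isCross hQ hc (x := ⟨i + j, by omega⟩) (y := (triforcePerm w).symm q)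
      (by rw [hx, hH]) (by simpa using hq)
    rw [Fin.lt_def] at hlt
    simp only at hlt
    have hy := triforcePerm_of_lt w (i := (triforcePerm w).symm q) (by omega)
    rw [Equiv.apply_symm_apply] at hy
    rw [← hy] at hlt
    omega
  have key : ∀ j i, i + j < n → H i j = i + j ∧ V i j = i + j := by
    apply edge_induction
    · exact fun i hi => hL.start i (by omega)
    · intro i j hij hp _
      rw [hL.turn_north i j (by omega) (not_cross i j hij hp), hp]
    · intro i j hij hp hq
      rw [hL.bump_east i j (by omega) (not_cross i j (by omega) hp), hq]
      omega
  by_contra hlt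
  exact not_cross i j (by omega) (key j i (by omega)).1 hc

theorem exists_triforce_eq {n : ℕ} {Q : PipeDream (2 * n)} {w : Equiv.Perm (Fin n)}
    (hQ : Q ∈ PD (triforcePerm w)) (h : ∀ i j, Q.IsCross i j → i < n ∧ j < n) :
    ∃ P ∈ PD w, P.triforce = Q := by
  have e : (ofCross n fun i j => Q.IsCross (n - 1 - j) (n - 1 - i)).triforce = Q := by
    refine ext_isCross fun i j => ?_
    rw [isCross_triforce, isCross_ofCross]
    constructor
    · rintro ⟨hi, hj, -, hc⟩
      rwa [Nat.sub_sub_self (by omega), Nat.sub_sub_self (by omega)] at hc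
    · intro hc
      obtain ⟨hi, hj⟩ := h i j hc
      have := le_of_isCross_of_triforcePerm hQ hc
      refine ⟨hi, hj, by omega, ?_⟩
      rwa [Nat.sub_sub_self (by omega), Nat.sub_sub_self (by omega)]
  exact ⟨_, triforce_mem_PD_iff.1 (by rwa [e]), e⟩

theorem isCross_iff_isCross_triforce {n : ℕ} {P : PipeDream n} {i j : ℕ} (hi : i < n)
    (hj : j < n) : P.IsCross i j ↔ P.triforce.IsCross (n - 1 - j) (n - 1 - i) := by
  rw [isCross_triforce, Nat.sub_sub_self (by omega), Nat.sub_sub_self (by omega)]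
  exact ⟨fun h => ⟨by omega, by omega, h⟩, fun h => h.2.2⟩

theorem triforce_injective {n : ℕ} : Function.Injective (triforce (n := n)) := by
  intro P P' h
  refine ext_isCross fun i j => ?_
  by_cases hij : i < n ∧ j < n
  · rw [isCross_iff_isCross_triforce hij.1 hij.2, isCross_iff_isCross_triforce hij.1 hij.2, h]
  · exact iff_of_false (fun h => by have := h.lt; omega) (fun h => by have := h.lt; omega)

theorem ChuteMove.triforce {n : ℕ} {P P' : PipeDream n} (h : P.ChuteMove P') :
    P.triforce.ChuteMove P'.triforce := by
  obtain ⟨r₁, r₂, c₁, c₂, hr, hc, hn, h1, h2, h3, hX, hX'⟩ := chuteMove_iff.1 h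
  simp only [ne_eq, Prod.mk.injEq] at hX hX'
  rw [chuteMove_iff]
  refine ⟨n - 1 - c₂, n - 1 - c₁, n - 1 - r₂, n - 1 - r₁, by omega, by omega, by omega, ?_⟩
  rw [← isCross_iff_isCross_triforce (by omega) (by omega),
    ← isCross_iff_isCross_triforce (by omega) (by omega),
    ← isCross_iff_isCross_triforce (by omega) (by omega)]
  simp only [ne_eq, Prod.mk.injEq]
  refine ⟨h3, h2, h1, ?_, ?_⟩
  · intro i j h4 h5 h6 h7 h8 h9 h10
    rw [isCross_triforce]
    exact ⟨by omega, by omega, hX _ _ (by omega) (by omega) (by omega) (by omega) (by omega)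
      (by omega) (by omega)⟩
  · intro i j
    rw [isCross_triforce, isCross_triforce, hX']
    constructor
    · rintro ⟨hi, hj, ⟨h, h'⟩ | h⟩
      · exact Or.inl ⟨⟨hi, hj, h⟩, by omega⟩
      · exact Or.inr (by omega)
    · rintro (⟨⟨hi, hj, h⟩, h'⟩ | h)
      · exact ⟨hi, hj, Or.inl ⟨h, by omega⟩⟩
      · exact ⟨by omega, by omega, Or.inr (by omega)⟩

theorem ChuteMove.of_triforce {n : ℕ} {P P' : PipeDream n}
    (h : P.triforce.ChuteMove P'.triforce) : P.ChuteMove P' := by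
  obtain ⟨r₁, r₂, c₁, c₂, hr, hc, hn, h1, h2, h3, hX, hX'⟩ := chuteMove_iff.1 h
  simp only [ne_eq, Prod.mk.injEq] at hX hX'
  have hNE := isCross_triforce.1
    (hX r₁ c₂ le_rfl hr.le hc.le le_rfl (by omega) (by omega) (by omega))
  -- This cross lies in the triangle, which puts its west neighbour, the northwest corner, on or
  -- below the line `i + j = n - 1`; hence the reflected southeast corner is a box of `P`.
  have hN := isCross_triforce.1
    (hX r₁ (c₁ + 1) le_rfl hr.le (by omega) hc (by omega) (by omega) (by omega))
  have hSW := isCross_triforce.1 ((hX' r₂ c₁).2 (Or.inr ⟨rfl, rfl⟩))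
  have hl := hN.2.2.lt
  rw [chuteMove_iff]
  refine ⟨n - 1 - c₂, n - 1 - c₁, n - 1 - r₂, n - 1 - r₁, by omega, by omega, by omega, ?_⟩
  have e : ∀ {R : PipeDream n} {i j : ℕ}, i < n → j < n →
      (R.IsCross (n - 1 - j) (n - 1 - i) ↔ R.triforce.IsCross i j) := fun hi hj => by
    rw [isCross_triforce]
    exact ⟨fun h => ⟨hi, hj, h⟩, fun h => h.2.2⟩
  rw [e (by omega) (by omega), e (by omega) (by omega), e (by omega) (by omega)]
  simp only [ne_eq, Prod.mk.injEq]
  refine ⟨h3, h2, h1, ?_, ?_⟩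
  · intro i j h4 h5 h6 h7 h8 h9 h10
    rw [isCross_iff_isCross_triforce (by omega) (by omega)]
    exact hX _ _ (by omega) (by omega) (by omega) (by omega) (by omega) (by omega) (by omega)
  · intro i j
    by_cases hij : i < n ∧ j < n
    · rw [isCross_iff_isCross_triforce hij.1 hij.2, isCross_iff_isCross_triforce hij.1 hij.2, hX']
      exact or_congr (and_congr_right fun _ => by omega) (by omega)
    · refine iff_of_false (fun h => by have := h.lt; omega) ?_
      rintro (⟨h, -⟩ | h)
      · have := h.lt
        omega
      · omega

/-! ### Chute moves move crosses to the southwest -/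

theorem ChuteMove.col_lt {n m : ℕ} {P P' : PipeDream n} (h : P.ChuteMove P')
    (hP : ∀ i j, P.IsCross i j → j < m) : ∀ i j, P'.IsCross i j → j < m := by
  obtain ⟨r₁, r₂, c₁, c₂, hr, hc, -, -, -, -, hX, hX'⟩ := chuteMove_iff.1 h
  intro i j hij
  obtain h | h := (hX' i j).1 hij
  · exact hP i j h.1
  · obtain ⟨rfl, rfl⟩ := Prod.mk.inj h
    exact hc.trans (hP _ _ (hX r₁ c₂ le_rfl hr.le hc.le le_rfl (by simp; omega) (by simp; omega)
      (by simp; omega)))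

theorem ChuteMove.row_lt {n m : ℕ} {P P' : PipeDream n} (h : P.ChuteMove P')
    (hP : ∀ i j, P'.IsCross i j → i < m) : ∀ i j, P.IsCross i j → i < m := by
  obtain ⟨r₁, r₂, c₁, c₂, hr, hc, -, -, -, -, hX, hX'⟩ := chuteMove_iff.1 h
  intro i j hij
  by_cases e : (i, j) = (r₁, c₂)
  · obtain ⟨rfl, rfl⟩ := Prod.mk.inj e
    exact hr.trans (hP _ _ ((hX' r₂ c₁).2 (Or.inr rfl)))
  · exact hP _ _ ((hX' i j).2 (Or.inl ⟨hij, e⟩))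

theorem col_lt_of_le {n m : ℕ} {w : Equiv.Perm (Fin n)} {P P' : PD w} (h : P ≤ P')
    (hP : ∀ i j, P.1.IsCross i j → j < m) : ∀ i j, P'.1.IsCross i j → j < m := by
  change Relation.ReflTransGen _ _ _ at h
  induction h with
  | refl => exact hP
  | tail _ h ih => exact h.col_lt ih

theorem row_lt_of_le {n m : ℕ} {w : Equiv.Perm (Fin n)} {P P' : PD w} (h : P ≤ P')
    (hP : ∀ i j, P'.1.IsCross i j → i < m) : ∀ i j, P.1.IsCross i j → i < m := by
  change Relation.ReflTransGen _ _ _ at h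
  induction h with
  | refl => exact hP
  | tail _ h ih => exact ih (h.row_lt hP)

/-- The map `P ↦ P^Tri` from `PD w` to `PD (triforcePerm w)`. -/
def triforcePD {n : ℕ} {w : Equiv.Perm (Fin n)} (P : PD w) : PD (triforcePerm w) :=
  ⟨P.1.triforce, triforce_mem_PD_iff.2 P.2⟩

theorem exists_triforcePD_eq {n : ℕ} {w : Equiv.Perm (Fin n)} {P P' : PD w}
    {Q : PD (triforcePerm w)} (h : triforcePD P ≤ Q) (h' : Q ≤ triforcePD P') :
    ∃ R : PD w, triforcePD R = Q := by
  obtain ⟨R, hR, e⟩ := exists_triforce_eq Q.2 fun i j hc =>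
    ⟨row_lt_of_le h' (fun _ _ h => (isCross_triforce.1 h).1) i j hc,
      col_lt_of_le h (fun _ _ h => (isCross_triforce.1 h).2.1) i j hc⟩
  exact ⟨⟨R, hR⟩, Subtype.ext e⟩

theorem triforcePD_le_iff {n : ℕ} {w : Equiv.Perm (Fin n)} {P P' : PD w} :
    triforcePD P ≤ triforcePD P' ↔ P ≤ P' := by
  constructor
  · intro h
    obtain ⟨Q, hQ⟩ : ∃ Q, triforcePD P = Q := ⟨_, rfl⟩
    rw [hQ] at h
    change Relation.ReflTransGen _ _ _ at h
    induction h using Relation.ReflTransGen.head_induction_on generalizing P with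
    | refl => exact le_of_eq (Subtype.ext (triforce_injective (congrArg Subtype.val hQ)))
    | head hc hle ih =>
      -- The next element of the chain lies between two images, hence is itself an image, and the
      -- move can be pulled back.
      obtain ⟨R, hR⟩ := exists_triforcePD_eq (P := P) (P' := P') (by
        rw [hQ]; exact le_of_chuteMove hc) hle
      subst hQ hR
      exact le_trans (le_of_chuteMove (ChuteMove.of_triforce hc)) (ih rfl)
  · intro h
    change Relation.ReflTransGen _ _ _ at h
    induction h with
    | refl => exact le_rfl
    | tail _ h ih => exact ih.trans (le_of_chuteMove h.triforce)

end PipeDream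

theorem mainTheorem4 (n : ℕ) (w : Equiv.Perm (Fin n)) :
    (∀ P ∈ PipeDream.PD w, P.triforce ∈ PipeDream.PD (triforcePerm w)) ∧
    ∃ A B : PipeDream.PD (triforcePerm w), A ≤ B ∧
      ∃ e : PipeDream.PD w ≃o Set.Icc A B,
        ∀ P : PipeDream.PD w, (e P).1.1 = P.1.triforce := by
  refine ⟨fun P hP => PipeDream.triforce_mem_PD_iff.2 hP, ?_⟩
  obtain ⟨A, hA⟩ := PipeDream.exists_least w
  obtain ⟨B, hB⟩ := PipeDream.exists_greatest w
  refine ⟨PipeDream.triforcePD A, PipeDream.triforcePD B,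
    PipeDream.triforcePD_le_iff.2 (hA B), ?_⟩
  let f : PipeDream.PD w ↪o Set.Icc (PipeDream.triforcePD A) (PipeDream.triforcePD B) :=
    OrderEmbedding.ofMapLEIff (fun P => ⟨PipeDream.triforcePD P,
      PipeDream.triforcePD_le_iff.2 (hA P), PipeDream.triforcePD_le_iff.2 (hB P)⟩)
      fun _ _ => PipeDream.triforcePD_le_iff
  refine ⟨RelIso.ofSurjective f ?_, fun P => rfl⟩
  rintro ⟨Q, hAQ, hQB⟩
  obtain ⟨R, hR⟩ := PipeDream.exists_triforcePD_eq hAQ hQB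
  exact ⟨R, Subtype.ext hR⟩
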